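/- Let $\mu\in\mathbb R$, $\sigma>0$, and let $X_1,X_2,\dots$ be independent real random variables on a probability space, each having the Cauchy distribution with location $\mu$ and scale $\sigma$, i.e. with density $x\mapsto\frac{\sigma}{\pi}\,\frac{1}{(x-\mu)^2+\sigma^2}$. Fix any integer $k$ and let $\log$ denote the branch $\log x=\log|x|+i(\arg x+2k\pi)$ of the logarithm for real $x\neq0$, where $\arg x=0$ if $x>0$ and $\arg x=\pi$ if $x<0$; set $x^{p}=\exp(p\log x)$ for $p\in\mathbb R$. For $N\ge 2$ let \[ P_N=\prod_{j=1}^N X_j^{1/N},\qquad V_N=\frac1{N-1}\sum_{j=1}^N|\log X_j|^2-\left|\frac1N\sum_{j=1}^N\log X_j\right|^2 . \] For $0<a<1$ let $\rho_a$ be the upper $a$-quantile of the standard real normal distribution, that is, $\int_{-\infty}^{\rho_a}\frac1{\sqrt{2\pi}}e^{-x^2/2}\,dx=1-a$. Then for every $0<\alpha\le1$, \[ \lim_{N\to\infty}P\left(\mathrm{Re}(P_N)-\frac{\sqrt{V_N}\,|P_N|}{\sqrt{2N}}\,\rho_{\alpha/2}\le\mu\le\mathrm{Re}(P_N)+\frac{\sqrt{V_N}\,|P_N|}{\sqrt{2N}}\,\rho_{\alpha/2}\right)=1-\alpha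 \] and \[ \lim_{N\to\infty}P\left(\mathrm{Im}(P_N)-\frac{\sqrt{V_N}\,|P_N|}{\sqrt{2N}}\,\rho_{\alpha/2}\le\sigma\le\mathrm{Im}(P_N)+\frac{\sqrt{V_N}\,|P_N|}{\sqrt{2N}}\,\rho_{\alpha/2}\right)=1-\alpha . \] -/

import Mathlib

open MeasureTheory ProbabilityTheory Filter Topology

/-- The `k`-th branch of the complex logarithm at a nonzero real number `x`:
`log |x| + (arg x + 2 k π) i`, where `arg x = 0` if `0 < x` and `arg x = π` if `x < 0`.
(`Complex.log` is the case `k = 0`; on the real axis its argument is the one in `[0, 2π)`.) -/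
noncomputable def branchLog (k : ℤ) (x : ℝ) : ℂ :=
  Complex.log (x : ℂ) + (2 * (k : ℝ) * Real.pi : ℝ) * Complex.I

/-- The power `x ^ p = exp (p log x)` of a nonzero real number, for the `k`-th branch of `log`. -/
noncomputable def branchPow (k : ℤ) (x p : ℝ) : ℂ :=
  Complex.exp ((p : ℂ) * branchLog k x)

/-- The geometric mean `P_N = ∏_{j} x_j ^ (1 / N)` of the first `N` terms of a real sequence
(a product of `N`-th roots, not the `N`-th root of the product). -/
noncomputable def geomMean (k : ℤ) (x : ℕ → ℝ) (N : ℕ) : ℂ :=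
  ∏ j ∈ Finset.range N, branchPow k (x j) (1 / (N : ℝ))

/-- The statistic `V_N = (N - 1)⁻¹ ∑_j |log x_j|² - |N⁻¹ ∑_j log x_j|²` (for `N ≥ 2`) of the
first `N` terms of a real sequence. -/
noncomputable def logVariance (k : ℤ) (x : ℕ → ℝ) (N : ℕ) : ℝ :=
  1 / ((N : ℝ) - 1) * ∑ j ∈ Finset.range N, ‖branchLog k (x j)‖ ^ 2
    - ‖1 / (N : ℂ) * ∑ j ∈ Finset.range N, branchLog k (x j)‖ ^ 2

/-- The upper `a`-quantile `ρ_a` of the standard real normal distribution, for `0 < a < 1`. -/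
noncomputable def normalUpperQuantile (a : ℝ) : ℝ :=
  sInf {x : ℝ | 1 - a ≤ cdf (gaussianReal 0 1) x}

/-- The characterization of `ρ_a`: the standard normal density has integral `1 - a` over
`(-∞, ρ_a]`. -/
theorem integral_Iic_normalUpperQuantile {a : ℝ} (h0 : 0 < a) (h1 : a < 1) :
    ∫ x in Set.Iic (normalUpperQuantile a),
      1 / Real.sqrt (2 * Real.pi) * Real.exp (-x ^ 2 / 2) = 1 - a := by
  have hcont : Continuous (cdf (gaussianReal 0 1)) := by
    rw [continuous_iff_continuousAt]
    intro x
    have hs := (cdf (gaussianReal 0 1)).measure_singleton x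
    have : NullSingletonClass (gaussianReal 0 1) := nullSingletonClass_gaussianReal one_ne_zero
    rw [measure_cdf, measure_singleton, eq_comm, ENNReal.ofReal_eq_zero] at hs
    rw [(monotone_cdf _).continuousAt_iff_leftLim_eq_rightLim, StieltjesFunction.rightLim_eq]
    exact le_antisymm ((monotone_cdf _).leftLim_le le_rfl) (by linarith)
  have hclosed : IsClosed {x : ℝ | 1 - a ≤ cdf (gaussianReal 0 1) x} :=
    isClosed_le continuous_const hcont
  have hbdd : BddBelow {x : ℝ | 1 - a ≤ cdf (gaussianReal 0 1) x} := by
    obtain ⟨b, hb⟩ := ((tendsto_cdf_atBot (gaussianReal 0 1)).eventually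
      (gt_mem_nhds (show (0 : ℝ) < 1 - a by linarith))).exists
    refine ⟨b, fun x hx => ?_⟩
    by_contra! hlt
    exact absurd (hx.trans (monotone_cdf _ hlt.le)) (not_le.2 hb)
  have hne : ∃ x, cdf (gaussianReal 0 1) x = 1 - a := by
    obtain ⟨b, hb⟩ := ((tendsto_cdf_atBot (gaussianReal 0 1)).eventually
      (gt_mem_nhds (show (0 : ℝ) < 1 - a by linarith))).exists
    obtain ⟨c, hc⟩ := ((tendsto_cdf_atTop (gaussianReal 0 1)).eventually
      (lt_mem_nhds (show 1 - a < (1 : ℝ) by linarith))).exists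
    exact mem_range_of_exists_le_of_exists_ge hcont ⟨b, hb.le⟩ ⟨c, hc.le⟩
  obtain ⟨x₀, hx₀⟩ := hne
  have hF : cdf (gaussianReal 0 1) (normalUpperQuantile a) = 1 - a :=
    le_antisymm (((monotone_cdf _) (csInf_le hbdd hx₀.ge)).trans hx₀.le)
      (hclosed.csInf_mem ⟨x₀, hx₀.ge⟩ hbdd)
  rw [cdf_eq_real, measureReal_def, gaussianReal_apply_eq_integral _ one_ne_zero,
    ENNReal.toReal_ofReal (integral_nonneg fun x => gaussianPDFReal_nonneg _ _ _)] at hF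
  rw [← hF]
  simp [gaussianPDFReal]

/-- The half-width `√V_N |P_N| / √(2N) · ρ_{α/2}` of the confidence intervals. -/
noncomputable def ciHalfWidth (k : ℤ) (x : ℕ → ℝ) (N : ℕ) (α : ℝ) : ℝ :=
  Real.sqrt (logVariance k x N) * ‖geomMean k x N‖ / Real.sqrt (2 * (N : ℝ))
    * normalUpperQuantile (α / 2)

/-! The Cauchy law is the harmonic measure of the upper half plane seen from `γ = μ + σ i`. Hence `E
f(X) = f(γ)` for `f` holomorphic there, with boundary values on the line away from `0` and moderate
growth at `0` and `∞` (`integrable_and_integral_cauchyMeasure`). Put `L = branchLog k X` and `m =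
log γ + 2kπi`. Taking `f` to be this branch and its square gives `E L = m` and `E L² = m²`, so the
pseudo-variance `E (L - m)²` vanishes. The Gaussian limit of `√N (mean of L - m)` is therefore
isotropic: in every direction its variance is `v / 2`, where `v = E |L - m|²`. Since `P_N` is `exp`
of the empirical mean and `exp m = γ`, the delta method (`tendstoInDistribution_re_exp_mean`) makes
`√N (P_N - γ)` asymptotically isotropic with variance `|γ|² v / 2` in each direction. The strong law
gives `V_N → v` and `|P_N| → |γ|`, so Slutsky's lemma allows the half-width to be estimated from the
sample (`tendsto_measureReal_abs_re_exp_mean_le`). Isotropy is why one half-width serves both `μ`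
and `σ`. -/

/-! ### The Cauchy law as a uniform angle, and circle averages. -/

/-- Under `x = μ + σ tan t` the Jacobian `σ / cos² t` cancels the Cauchy density down to the
constant `1 / π`. -/
theorem cauchyMeasure_eq_map_tan (μ : ℝ) {σ : NNReal} (hσ : 0 < σ) :
    cauchyMeasure μ σ = Measure.map (fun t => μ + σ * Real.tan t)
      (ENNReal.ofReal Real.pi⁻¹ • volume.restrict (Set.Ioo (-(Real.pi / 2)) (Real.pi / 2))) := by
  have hσ' : (0 : ℝ) < σ := by exact_mod_cast hσ
  have hm : Measurable (fun t => μ + σ * Real.tan t) := by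
    have : Measurable Real.tan := by
      simp only [funext Real.tan_eq_sin_div_cos]
      fun_prop
    fun_prop
  have himg : (fun t => μ + σ * Real.tan t) '' Set.Ioo (-(Real.pi / 2)) (Real.pi / 2)
      = Set.univ := by
    refine Set.eq_univ_of_forall fun x => ⟨Real.arctan ((x - μ) / σ),
      Real.arctan_mem_Ioo _, ?_⟩
    simp only [Real.tan_arctan]
    field_simp
    ring
  have hinj : Set.InjOn (fun t => μ + σ * Real.tan t)
      (Set.Ioo (-(Real.pi / 2)) (Real.pi / 2)) := by
    intro a ha b hb h
    refine Real.injOn_tan ha hb ?_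
    simpa [hσ'.ne'] using h
  ext s hs
  rw [cauchyMeasure_of_scale_ne_zero μ hσ.ne', withDensity_apply _ hs, Measure.map_apply hm hs,
    Measure.smul_apply, Measure.restrict_apply (hm hs), ← lintegral_indicator hs]
  rw [← setLIntegral_univ, ← himg, lintegral_image_eq_lintegral_abs_deriv_mul measurableSet_Ioo
    (f' := fun t => σ * (1 / Real.cos t ^ 2))
    (fun t ht => (((Real.hasDerivAt_tan_of_mem_Ioo ht).const_mul (σ : ℝ)).const_add
      μ).hasDerivWithinAt) hinj]
  have hind : ∀ t ∈ Set.Ioo (-(Real.pi / 2)) (Real.pi / 2),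
      ENNReal.ofReal |σ * (1 / Real.cos t ^ 2)| * s.indicator (cauchyPDF μ σ) (μ + σ * Real.tan t)
      = ((fun t => μ + σ * Real.tan t) ⁻¹' s).indicator (fun _ => ENNReal.ofReal Real.pi⁻¹) t := by
    intro t ht
    have hc : 0 < Real.cos t := Real.cos_pos_of_mem_Ioo ht
    by_cases h : μ + σ * Real.tan t ∈ s
    · rw [Set.indicator_of_mem h, Set.indicator_of_mem (show t ∈ _ from h), cauchyPDF,
        ← ENNReal.ofReal_mul (abs_nonneg _), abs_of_pos (by positivity), cauchyPDFReal]
      congr 1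
      have h2 : (μ + σ * Real.tan t - μ) ^ 2 + (σ : ℝ) ^ 2 = σ ^ 2 / Real.cos t ^ 2 := by
        rw [Real.tan_eq_sin_div_cos]
        field_simp
        linear_combination (σ : ℝ) ^ 2 * Real.sin_sq_add_cos_sq t
      rw [h2]
      field_simp
    · rw [Set.indicator_of_notMem h, Set.indicator_of_notMem (show t ∉ _ from h), mul_zero]
  rw [setLIntegral_congr_fun measurableSet_Ioo hind, lintegral_indicator (hm hs),
    lintegral_const, Measure.restrict_apply_univ, Measure.restrict_apply (hm hs), smul_eq_mul]

/-- The mean value property of a holomorphic function on the unit disc, on the circle of radius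
`r`, parametrized by the angle `2 t`. -/
theorem integral_Ioo_circle_eq {h : ℂ → ℂ} (hh : DifferentiableOn ℂ h (Metric.ball 0 1))
    {r : ℝ} (hr0 : 0 ≤ r) (hr : r < 1) :
    ∫ t in Set.Ioo (-(Real.pi / 2)) (Real.pi / 2), h (r * Complex.exp (2 * t * Complex.I))
      = Real.pi * h 0 := by
  have hmv : Real.circleAverage h 0 r = h 0 := by
    refine DiffContOnCl.circleAverage (hh.diffContOnCl_ball ?_)
    rw [abs_of_nonneg hr0]
    exact Metric.closedBall_subset_ball hr
  have hper : (fun θ => h (circleMap 0 r θ)).Periodic (2 * Real.pi) :=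
    fun x => by simp [periodic_circleMap 0 r x]
  rw [← integral_Ioc_eq_integral_Ioo, ← intervalIntegral.integral_of_le (by linarith [Real.pi_pos])]
  have h1 : ∀ t : ℝ, h (r * Complex.exp (2 * t * Complex.I)) =
      (fun θ => h (circleMap 0 r θ)) (2 * t) := by
    intro t; simp [circleMap]
  simp_rw [h1]
  rw [intervalIntegral.integral_comp_mul_left (fun θ => h (circleMap 0 r θ)) two_ne_zero,
    show (2 : ℝ) * (Real.pi / 2) = 2 * -(Real.pi / 2) + 2 * Real.pi by ring,
    hper.intervalIntegral_add_eq _ 0, zero_add]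
  rw [Real.circleAverage_def] at hmv
  rw [← hmv, Complex.real_smul, Complex.real_smul]
  push_cast
  field_simp

/-! ### Integrability of the pieces of the dominating function. -/

/-- With `q = (x - μ)² + σ²`, the exponent comes from the density, of order `q⁻¹`, times the allowed
growth `|γ - x|^(1/2) = q^(1/4)`. -/
theorem integrable_rpow_cauchy_tail (μ : ℝ) {σ : NNReal} (hσ : 0 < σ) :
    Integrable (fun x : ℝ => ((x - μ) ^ 2 + (σ : ℝ) ^ 2) ^ (-(3 / 4) : ℝ)) := by
  have hσ' : (0 : ℝ) < σ := by exact_mod_cast hσ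
  have h := integrable_rpow_neg_one_add_norm_sq (E := ℝ) (μ := volume) (r := 3 / 2)
    (by norm_num)
  have h2 := ((h.comp_div hσ'.ne').comp_sub_right μ).const_mul (((σ : ℝ) ^ 2) ^ (-(3 / 4) : ℝ))
  refine h2.congr (ae_of_all _ fun x => ?_)
  simp only
  rw [show (-(3 / 2) / 2 : ℝ) = -(3 / 4) by norm_num, ← Real.mul_rpow (by positivity) (by positivity)]
  congr 1
  rw [Real.norm_eq_abs, sq_abs]
  field_simp
  ring

theorem integrable_indicator_abs_rpow :
    Integrable ((Set.Icc (-1 : ℝ) 1).indicator fun x => |x| ^ (-(1 / 2) : ℝ)) := by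
  rw [integrable_indicator_iff measurableSet_Icc]
  have h0 : IntegrableOn (fun x : ℝ => |x| ^ (-(1 / 2) : ℝ)) (Set.Ioo 0 1) := by
    refine ((intervalIntegral.integrableOn_Ioo_rpow_iff (s := -(1/2)) one_pos).2
      (by norm_num)).congr_fun (fun x hx => ?_) measurableSet_Ioo
    simp only [abs_of_pos hx.1]
  have h1 : IntegrableOn (fun x : ℝ => |x| ^ (-(1 / 2) : ℝ)) (Set.Ioo (-1) 0) := by
    have := h0.integrable_indicator measurableSet_Ioo
    have := this.comp_neg
    refine (integrable_indicator_iff measurableSet_Ioo).1 (this.congr (ae_of_all _ fun x => ?_))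
    simp only [Set.indicator, Set.mem_Ioo, abs_neg]
    congr 1
    apply propext
    constructor <;> rintro ⟨h, h'⟩ <;> constructor <;> linarith
  have h2 : IntegrableOn (fun x : ℝ => |x| ^ (-(1 / 2) : ℝ)) {-1, 0, 1} :=
    IntegrableOn.of_measure_zero ((Set.toFinite _).measure_zero _)
  refine ((h0.union h1).union h2).mono_set ?_
  intro x hx
  rcases lt_trichotomy x 0 with h | h | h
  · rcases hx.1.eq_or_lt with h' | h'
    · exact Or.inr (Or.inl h'.symm)
    · exact Or.inl (Or.inr ⟨h', h⟩)
  · simp [h]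
  · rcases hx.2.eq_or_lt with h' | h'
    · exact Or.inr (by simp [h'])
    · exact Or.inl (Or.inl ⟨h, h'⟩)

/-! ### The Möbius map between disc and half plane, with bounds uniform in the radius. -/

/-- The Möbius map from the unit disc onto the upper half plane which sends `0` to `γ`. -/
noncomputable def discToHalfPlane (γ w : ℂ) : ℂ := (γ + (starRingEnd ℂ) γ * w) / (1 + w)

theorem discToHalfPlane_zero (γ : ℂ) : discToHalfPlane γ 0 = γ := by simp [discToHalfPlane]

theorem one_add_ne_zero_of_norm_lt_one {w : ℂ} (hw : ‖w‖ < 1) : 1 + w ≠ 0 := by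
  intro h
  have : w = -1 := by linear_combination h
  simp [this] at hw

theorem discToHalfPlane_im_pos {γ w : ℂ} (hγ : 0 < γ.im) (hw : ‖w‖ < 1) :
    0 < (discToHalfPlane γ w).im := by
  have hne := one_add_ne_zero_of_norm_lt_one hw
  have h1 : 0 < Complex.normSq (1 + w) := Complex.normSq_pos.2 hne
  have h2 : Complex.normSq w < 1 := by
    rw [Complex.normSq_eq_norm_sq]; nlinarith [norm_nonneg w]
  have : (discToHalfPlane γ w).im = γ.im * (1 - Complex.normSq w) / Complex.normSq (1 + w) := by
    rw [discToHalfPlane, Complex.div_im]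
    field_simp
    simp [Complex.normSq_apply]
    ring
  rw [this]
  have : 0 < 1 - Complex.normSq w := by linarith
  positivity

theorem differentiableOn_discToHalfPlane (γ : ℂ) :
    DifferentiableOn ℂ (discToHalfPlane γ) (Metric.ball 0 1) := by
  intro w hw
  have hne := one_add_ne_zero_of_norm_lt_one (mem_ball_zero_iff.1 hw)
  unfold discToHalfPlane
  exact (DifferentiableAt.div (by fun_prop) (by fun_prop) hne).differentiableWithinAt

/-- The inverse of `discToHalfPlane γ`, on the real line. -/
noncomputable def lineToCircle (γ : ℂ) (x : ℝ) : ℂ := (γ - x) / (x - (starRingEnd ℂ) γ)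

theorem norm_ofReal_sub_conj (γ : ℂ) (x : ℝ) : ‖(x : ℂ) - (starRingEnd ℂ) γ‖ = ‖γ - x‖ := by
  rw [← Complex.norm_conj, ← norm_neg]
  simp

section

variable {γ : ℂ} (hγ : 0 < γ.im)
include hγ

theorem ofReal_sub_conj_ne_zero (x : ℝ) : (x : ℂ) - (starRingEnd ℂ) γ ≠ 0 := by
  intro h
  have := congrArg Complex.im h
  simp at this
  exact hγ.ne' this

theorem norm_lineToCircle (x : ℝ) : ‖lineToCircle γ x‖ = 1 := by
  have h := norm_pos_iff.2 (ofReal_sub_conj_ne_zero hγ x)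
  rw [lineToCircle, norm_div, norm_ofReal_sub_conj, div_self]
  rw [← norm_ofReal_sub_conj]
  exact h.ne'

theorem one_add_lineToCircle (x : ℝ) :
    1 + lineToCircle γ x = 2 * γ.im * Complex.I / (x - (starRingEnd ℂ) γ) := by
  have h := ofReal_sub_conj_ne_zero hγ x
  rw [lineToCircle]
  field_simp
  apply Complex.ext <;> simp
  ring

theorem add_conj_mul_lineToCircle (x : ℝ) :
    γ + (starRingEnd ℂ) γ * lineToCircle γ x = x * (1 + lineToCircle γ x) := by
  have h := ofReal_sub_conj_ne_zero hγ x
  rw [lineToCircle]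
  field_simp
  ring

theorem norm_one_add_lineToCircle (x : ℝ) : ‖1 + lineToCircle γ x‖ = 2 * γ.im / ‖γ - x‖ := by
  rw [one_add_lineToCircle hγ, norm_div, norm_ofReal_sub_conj]
  simp [abs_of_pos hγ]

theorem one_add_lineToCircle_ne_zero (x : ℝ) : 1 + lineToCircle γ x ≠ 0 := by
  rw [one_add_lineToCircle hγ]
  refine div_ne_zero ?_ (ofReal_sub_conj_ne_zero hγ x)
  simp [hγ.ne']

theorem discToHalfPlane_lineToCircle (x : ℝ) : discToHalfPlane γ (lineToCircle γ x) = x := by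
  rw [discToHalfPlane, add_conj_mul_lineToCircle hγ,
    mul_div_cancel_right₀ _ (one_add_lineToCircle_ne_zero hγ x)]

theorem continuous_lineToCircle : Continuous (lineToCircle γ) := by
  unfold lineToCircle
  exact Continuous.div (by fun_prop) (by fun_prop) (ofReal_sub_conj_ne_zero hγ)

end

/-- Moving a boundary point of a disc radially inwards at most halves its distance to another
boundary point. -/
theorem norm_add_le_two_mul_norm_add_mul {a b : ℂ} (hab : ‖b‖ = ‖a‖) {r : ℝ} (hr0 : 0 ≤ r)
    (hr : r ≤ 1) : ‖a + b‖ ≤ 2 * ‖a + r * b‖ := by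
  have h1 : a + b = (a + r * b) + (1 - r : ℝ) * b := by push_cast; ring
  -- As `‖a‖ = ‖b‖`, the left side is `‖a‖ - ‖r b‖`, so this is the reverse triangle inequality.
  have h2 : (1 - r) * ‖b‖ ≤ ‖a + r * b‖ := by
    have := norm_sub_norm_le a (-(r * b))
    rw [norm_neg, norm_mul, Complex.norm_real, Real.norm_of_nonneg hr0, sub_neg_eq_add] at this
    rw [hab] at *
    linarith
  calc ‖a + b‖ ≤ ‖a + r * b‖ + ‖((1 - r : ℝ) : ℂ) * b‖ := by rw [h1]; exact norm_add_le _ _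
    _ ≤ _ := by
      rw [norm_mul, Complex.norm_real, Real.norm_of_nonneg (by linarith)]
      linarith

section

variable {γ : ℂ} (hγ : 0 < γ.im) {r : ℝ} (hr0 : 0 ≤ r) (hr : r < 1)
include hγ hr0 hr

theorem norm_mul_lineToCircle_lt (x : ℝ) : ‖(r : ℂ) * lineToCircle γ x‖ < 1 := by
  rw [norm_mul, norm_lineToCircle hγ, Complex.norm_real, Real.norm_of_nonneg hr0]
  linarith

/-- The numerator is at most `2 ‖γ‖`, and the denominator is at least half its boundary value `2
γ.im / ‖γ - x‖`. The bound is free of `r`, as dominated convergence requires. -/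
theorem norm_discToHalfPlane_le (x : ℝ) :
    ‖discToHalfPlane γ (r * lineToCircle γ x)‖ ≤ 2 * ‖γ‖ / γ.im * ‖γ - x‖ := by
  have h1 := norm_add_le_two_mul_norm_add_mul (a := 1) (b := lineToCircle γ x)
    (by simp [norm_lineToCircle hγ]) hr0 hr.le
  have hD : 0 < ‖γ - x‖ := by
    rw [← norm_ofReal_sub_conj]; exact norm_pos_iff.2 (ofReal_sub_conj_ne_zero hγ x)
  have hpos : 0 < ‖1 + (r : ℂ) * lineToCircle γ x‖ :=
    norm_pos_iff.2 (one_add_ne_zero_of_norm_lt_one (norm_mul_lineToCircle_lt hγ hr0 hr x))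
  rw [norm_one_add_lineToCircle hγ] at h1
  have h2 : ‖γ + (starRingEnd ℂ) γ * (r * lineToCircle γ x)‖ ≤ 2 * ‖γ‖ := by
    refine (norm_add_le _ _).trans ?_
    rw [norm_mul, Complex.norm_conj]
    nlinarith [norm_nonneg γ, norm_mul_lineToCircle_lt hγ hr0 hr x]
  rw [discToHalfPlane, norm_div, div_le_iff₀ hpos]
  refine h2.trans ?_
  have h3 : γ.im ≤ ‖γ - x‖ * ‖1 + (r : ℂ) * lineToCircle γ x‖ := by
    rw [div_le_iff₀ hD] at h1
    linarith
  calc 2 * ‖γ‖ = 2 * ‖γ‖ / γ.im * γ.im := by field_simp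
    _ ≤ 2 * ‖γ‖ / γ.im * (‖γ - x‖ * ‖1 + (r : ℂ) * lineToCircle γ x‖) := by gcongr
    _ = _ := by ring

/-- Here the halving argument applies to the numerator, whose boundary value is `x (1 + w)`; the
denominator is at most `2`. This controls the singularity at `0`. -/
theorem le_norm_discToHalfPlane (x : ℝ) :
    γ.im * |x| / (2 * ‖γ - x‖) ≤ ‖discToHalfPlane γ (r * lineToCircle γ x)‖ := by
  have h1 := norm_add_le_two_mul_norm_add_mul (a := γ) (b := (starRingEnd ℂ) γ * lineToCircle γ x)
    (by rw [norm_mul, norm_lineToCircle hγ, Complex.norm_conj, mul_one]) hr0 hr.le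
  have hD : 0 < ‖γ - x‖ := by
    rw [← norm_ofReal_sub_conj]; exact norm_pos_iff.2 (ofReal_sub_conj_ne_zero hγ x)
  have hpos : 0 < ‖1 + (r : ℂ) * lineToCircle γ x‖ :=
    norm_pos_iff.2 (one_add_ne_zero_of_norm_lt_one (norm_mul_lineToCircle_lt hγ hr0 hr x))
  have hle : ‖1 + (r : ℂ) * lineToCircle γ x‖ ≤ 2 := by
    refine (norm_add_le _ _).trans ?_
    rw [norm_one]
    linarith [norm_mul_lineToCircle_lt hγ hr0 hr x]
  rw [add_conj_mul_lineToCircle hγ, norm_mul, norm_one_add_lineToCircle hγ, Complex.norm_real,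
    Real.norm_eq_abs, mul_left_comm] at h1
  rw [discToHalfPlane, norm_div, le_div_iff₀ hpos]
  calc γ.im * |x| / (2 * ‖γ - x‖) * ‖1 + (r : ℂ) * lineToCircle γ x‖
      ≤ γ.im * |x| / (2 * ‖γ - x‖) * 2 := by gcongr
    _ = |x| * (2 * γ.im / ‖γ - x‖) / 2 := by field_simp
    _ ≤ _ := by linarith

end

/-! ### The Cauchy law as harmonic measure. -/

/-- The quotient is `i e^{it} / (i e^{-it})` after cancelling `σ / cos t`. So the uniform angle `t`
on an interval of length `π` becomes a uniform point of the circle. -/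
theorem exp_two_mul_eq_lineToCircle {μ σ t : ℝ} (hσ : 0 < σ) (ht : Real.cos t ≠ 0) :
    lineToCircle (μ + σ * Complex.I) (μ + σ * Real.tan t) = Complex.exp (2 * t * Complex.I) := by
  have him : 0 < (μ + σ * Complex.I : ℂ).im := by simpa using hσ
  have h := ofReal_sub_conj_ne_zero him (μ + σ * Real.tan t)
  rw [lineToCircle, div_eq_iff h, show (2 * t * Complex.I : ℂ) = (2 : ℕ) * (t * Complex.I) by
    push_cast; ring, Complex.exp_nat_mul, Complex.exp_mul_I, Real.tan_eq_sin_div_cos]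
  have hc : Complex.cos t ≠ 0 := by exact_mod_cast ht
  push_cast
  simp only [map_add, map_mul, Complex.conj_ofReal, Complex.conj_I]
  field_simp
  linear_combination (σ : ℂ) * (Complex.sin t - Complex.I * Complex.cos t) *
    (Complex.sin_sq_add_cos_sq (t : ℂ)) - (σ : ℂ) * (Complex.I * Complex.cos t * Complex.sin t ^ 2 +
      2 * Complex.cos t ^ 2 * Complex.sin t + Complex.sin t ^ 3) * Complex.I_sq

theorem integral_discToHalfPlane_lineToCircle {f : ℂ → ℂ} (hf : DifferentiableOn ℂ f {z | 0 < z.im})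
    (hm : Measurable f) (μ : ℝ) {σ : NNReal} (hσ : 0 < σ) {r : ℝ} (hr0 : 0 ≤ r) (hr : r < 1) :
    ∫ x, f (discToHalfPlane (μ + σ * Complex.I) (r * lineToCircle (μ + σ * Complex.I) x))
      ∂(cauchyMeasure μ σ) = f (μ + σ * Complex.I) := by
  have hσ' : (0 : ℝ) < σ := by exact_mod_cast hσ
  have him : 0 < (μ + σ * Complex.I : ℂ).im := by simpa using hσ'
  have hd : DifferentiableOn ℂ (fun w => f (discToHalfPlane (μ + σ * Complex.I) w))
      (Metric.ball 0 1) :=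
    hf.comp (differentiableOn_discToHalfPlane _)
      fun w hw => discToHalfPlane_im_pos him (mem_ball_zero_iff.1 hw)
  have hlm : Measurable (lineToCircle (μ + σ * Complex.I)) := (continuous_lineToCircle him).measurable
  have htm : Measurable (fun t => μ + σ * Real.tan t) := by
    simp only [funext Real.tan_eq_sin_div_cos]
    fun_prop
  rw [cauchyMeasure_eq_map_tan μ hσ, integral_map htm.aemeasurable, integral_smul_measure,
    setIntegral_congr_fun (g := fun t : ℝ => f (discToHalfPlane (μ + σ * Complex.I)
      (r * Complex.exp (2 * t * Complex.I)))) measurableSet_Ioo, integral_Ioo_circle_eq hd hr0 hr,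
      discToHalfPlane_zero]
  · rw [ENNReal.toReal_ofReal (by positivity), Complex.real_smul]
    push_cast
    field_simp
  · intro t ht
    simp only
    rw [exp_two_mul_eq_lineToCircle hσ' (Real.cos_pos_of_mem_Ioo ht).ne']
  · refine (hm.comp ?_).aestronglyMeasurable
    unfold discToHalfPlane
    fun_prop

theorem cauchyMeasure_absolutelyContinuous (μ : ℝ) {σ : NNReal} (hσ : 0 < σ) :
    cauchyMeasure μ σ ≪ volume := by
  rw [cauchyMeasure_of_scale_ne_zero μ hσ.ne']
  exact withDensity_absolutelyContinuous _ _

theorem norm_add_mul_I_sub_ofReal (μ σ x : ℝ) :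
    ‖(μ + σ * Complex.I : ℂ) - x‖ = ((x - μ) ^ 2 + σ ^ 2) ^ (1 / 2 : ℝ) := by
  rw [← Real.sqrt_eq_rpow, show (μ + σ * Complex.I : ℂ) - x = (μ - x : ℝ) + σ * Complex.I by
    push_cast; ring, Complex.norm_add_mul_I]
  congr 1
  ring

theorem integrable_cauchyMeasure_rpow (μ : ℝ) {σ : NNReal} (hσ : 0 < σ) :
    Integrable (fun x : ℝ => ‖(μ + σ * Complex.I : ℂ) - x‖ ^ (1 / 2 : ℝ) *
      (1 + |x| ^ (-(1 / 2) : ℝ))) (cauchyMeasure μ σ) := by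
  have hσ' : (0 : ℝ) < σ := by exact_mod_cast hσ
  rw [cauchyMeasure_of_scale_ne_zero μ hσ.ne', integrable_withDensity_iff
    (measurable_cauchyPDF μ σ) (ae_of_all _ fun x => ENNReal.ofReal_lt_top)]
  -- For `|x| > 1` the factor `1 + |x|^(-1/2)` is at most `2`; for `|x| ≤ 1` the singular term is
  -- bounded using `q ≥ σ²`.
  have hg := ((integrable_rpow_cauchy_tail μ hσ).const_mul (2 * (Real.pi⁻¹ * σ))).add
    (integrable_indicator_abs_rpow.const_mul
      ((Real.pi⁻¹ * σ) * ((σ : ℝ) ^ 2) ^ (-(3 / 4) : ℝ)))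
  refine hg.mono' ?_ (ae_of_all _ fun x => ?_)
  · have : Measurable fun x : ℝ => (cauchyPDF μ σ x).toReal :=
      (measurable_cauchyPDF μ σ).ennreal_toReal
    exact Measurable.aestronglyMeasurable (by fun_prop)
  · set q : ℝ := (x - μ) ^ 2 + (σ : ℝ) ^ 2 with hq
    have hq0 : 0 < q := by positivity
    have hqσ : (σ : ℝ) ^ 2 ≤ q := by rw [hq]; nlinarith [sq_nonneg (x - μ)]
    have h1 : (cauchyPDF μ σ x).toReal = Real.pi⁻¹ * σ * q⁻¹ := by
      rw [cauchyPDF, ENNReal.toReal_ofReal (cauchyPDF_pos μ hσ.ne' x).le, cauchyPDFReal]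
    have h2 : ‖(μ + σ * Complex.I : ℂ) - x‖ ^ (1 / 2 : ℝ) * q⁻¹ = q ^ (-(3 / 4) : ℝ) := by
      have := norm_add_mul_I_sub_ofReal μ σ x
      rw [this, ← hq, ← Real.rpow_mul hq0.le, ← Real.rpow_neg_one, ← Real.rpow_add hq0]
      norm_num
    have h3 : q ^ (-(3 / 4) : ℝ) ≤ ((σ : ℝ) ^ 2) ^ (-(3 / 4) : ℝ) :=
      Real.rpow_le_rpow_of_nonpos (by positivity) hqσ (by norm_num)
    have h4 : 0 ≤ q ^ (-(3 / 4) : ℝ) := by positivity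
    have h5 : 0 ≤ |x| ^ (-(1 / 2) : ℝ) := by positivity
    rw [Real.norm_of_nonneg (by rw [h1]; positivity), h1]
    have h6 : ‖(μ + σ * Complex.I : ℂ) - x‖ ^ (1 / 2 : ℝ) * (1 + |x| ^ (-(1 / 2) : ℝ)) *
        (Real.pi⁻¹ * σ * q⁻¹) =
        (Real.pi⁻¹ * σ) * (q ^ (-(3 / 4) : ℝ) * (1 + |x| ^ (-(1 / 2) : ℝ))) := by
      rw [← h2]; ring
    rw [h6]
    simp only [Pi.add_apply]
    rw [show 2 * (Real.pi⁻¹ * (σ : ℝ)) * q ^ (-(3 / 4) : ℝ) +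
      Real.pi⁻¹ * ↑σ * ((σ : ℝ) ^ 2) ^ (-(3 / 4) : ℝ) *
        (Set.Icc (-1) 1).indicator (fun x => |x| ^ (-(1 / 2) : ℝ)) x =
        (Real.pi⁻¹ * (σ : ℝ)) * (2 * q ^ (-(3 / 4) : ℝ) + ((σ : ℝ) ^ 2) ^ (-(3 / 4) : ℝ) *
        (Set.Icc (-1) 1).indicator (fun x => |x| ^ (-(1 / 2) : ℝ)) x) by ring]
    refine mul_le_mul_of_nonneg_left ?_ (by positivity)
    by_cases hx : x ∈ Set.Icc (-1 : ℝ) 1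
    · rw [Set.indicator_of_mem hx]
      nlinarith [mul_le_mul_of_nonneg_right h3 h5]
    · rw [Set.indicator_of_notMem hx]
      have : 1 ≤ |x| := by
        by_contra! h
        exact hx (abs_le.1 h.le)
      have : |x| ^ (-(1 / 2) : ℝ) ≤ 1 := Real.rpow_le_one_of_one_le_of_nonpos this (by norm_num)
      nlinarith

/-- The Cauchy distribution is the harmonic measure of the upper half plane: it integrates the
boundary values of a holomorphic function of moderate growth to its value at `μ + σ i`. -/
theorem integrable_and_integral_cauchyMeasure {f : ℂ → ℂ}
    (hf : DifferentiableOn ℂ f {z | 0 < z.im}) (hm : Measurable f)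
    (hlim : ∀ x : ℝ, x ≠ 0 → Tendsto f (𝓝[{z | 0 < z.im}] (x : ℂ)) (𝓝 (f x)))
    {C : ℝ} (hC : ∀ z : ℂ, z ≠ 0 → ‖f z‖ ≤ C * (‖z‖ ^ (1 / 2 : ℝ) + ‖z‖ ^ (-(1 / 2) : ℝ)))
    (μ : ℝ) {σ : NNReal} (hσ : 0 < σ) :
    Integrable (fun x : ℝ => f x) (cauchyMeasure μ σ) ∧
      ∫ x, f x ∂(cauchyMeasure μ σ) = f (μ + σ * Complex.I) := by
  have hσ' : (0 : ℝ) < σ := by exact_mod_cast hσ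
  set γ : ℂ := μ + σ * Complex.I with hγ
  have him : 0 < γ.im := by simpa [hγ] using hσ'
  have hγ0 : 0 < ‖γ‖ := norm_pos_iff.2 (fun h => by simp [h] at him)
  have hC0 : 0 ≤ C := by
    have := (norm_nonneg _).trans (hC 1 one_ne_zero)
    simp at this
    linarith
  have hx0 : ∀ᵐ x ∂(cauchyMeasure μ σ), x ≠ 0 :=
    (cauchyMeasure_absolutelyContinuous μ hσ).ae_le (Measure.ae_ne volume 0)
  -- Radii increasing to `1`: the mean value property is exact for each of them, and dominated
  -- convergence carries it to the boundary.
  set r : ℕ → ℝ := fun n => 1 - 1 / ((n : ℝ) + 1) with hr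
  have hr0 : ∀ n, 0 ≤ r n := fun n => by
    simp only [hr, sub_nonneg]
    rw [div_le_one (by positivity)]
    linarith [(Nat.cast_nonneg n : (0 : ℝ) ≤ n)]
  have hr1 : ∀ n, r n < 1 := fun n => by
    simp only [hr, sub_lt_self_iff]
    positivity
  have hrlim : Tendsto r atTop (𝓝 1) := by
    simpa [hr] using
      (tendsto_const_nhds (x := (1 : ℝ))).sub tendsto_one_div_add_atTop_nhds_zero_nat
  set F : ℕ → ℝ → ℂ := fun n x => f (discToHalfPlane γ (r n * lineToCircle γ x)) with hF
  set K : ℝ := C * ((2 * ‖γ‖ / γ.im) ^ (1 / 2 : ℝ) + (γ.im / 2) ^ (-(1 / 2) : ℝ)) with hK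
  set G : ℝ → ℝ := fun x => K * (‖γ - x‖ ^ (1 / 2 : ℝ) * (1 + |x| ^ (-(1 / 2) : ℝ))) with hG
  have hGint : Integrable G (cauchyMeasure μ σ) := (integrable_cauchyMeasure_rpow μ hσ).const_mul K
  have hFm : ∀ n, AEStronglyMeasurable (F n) (cauchyMeasure μ σ) := by
    intro n
    have := (continuous_lineToCircle him).measurable
    refine (hm.comp ?_).aestronglyMeasurable
    unfold discToHalfPlane
    fun_prop
  have hbound : ∀ n, ∀ x : ℝ, x ≠ 0 → ‖F n x‖ ≤ G x := by
    intro n x hx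
    have hup := norm_discToHalfPlane_le him (hr0 n) (hr1 n) x
    have hlo := le_norm_discToHalfPlane him (hr0 n) (hr1 n) x
    have hD : 0 < ‖γ - x‖ := by
      rw [← norm_ofReal_sub_conj]; exact norm_pos_iff.2 (ofReal_sub_conj_ne_zero him x)
    have hxp : 0 < |x| := abs_pos.2 hx
    have hlo' : 0 < γ.im * |x| / (2 * ‖γ - x‖) := by positivity
    set z := discToHalfPlane γ (r n * lineToCircle γ x)
    have hz : z ≠ 0 := norm_pos_iff.1 (hlo'.trans_le hlo)
    have e1 : ‖z‖ ^ (1 / 2 : ℝ) ≤ (2 * ‖γ‖ / γ.im) ^ (1 / 2 : ℝ) * ‖γ - x‖ ^ (1 / 2 : ℝ) := by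
      rw [← Real.mul_rpow (by positivity) (by positivity)]
      exact Real.rpow_le_rpow (norm_nonneg _) hup (by norm_num)
    have e2 : ‖z‖ ^ (-(1 / 2) : ℝ) ≤ (γ.im / 2) ^ (-(1 / 2) : ℝ) *
        (‖γ - x‖ ^ (1 / 2 : ℝ) * |x| ^ (-(1 / 2) : ℝ)) := by
      have h1 : ‖γ - x‖ ^ (1 / 2 : ℝ) = (‖γ - x‖⁻¹) ^ (-(1 / 2) : ℝ) := by
        rw [Real.inv_rpow hD.le, Real.rpow_neg hD.le, inv_inv]
      rw [h1, ← Real.mul_rpow (by positivity) (by positivity),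
        ← Real.mul_rpow (by positivity) (by positivity)]
      refine Real.rpow_le_rpow_of_nonpos (by positivity) ?_ (by norm_num)
      refine le_trans (le_of_eq ?_) hlo
      field_simp
    refine (hC z hz).trans ?_
    simp only [hG, hK]
    rw [mul_assoc]
    refine mul_le_mul_of_nonneg_left ?_ hC0
    have p1 : 0 ≤ (2 * ‖γ‖ / γ.im) ^ (1 / 2 : ℝ) := by positivity
    have p2 : 0 ≤ (γ.im / 2) ^ (-(1 / 2) : ℝ) := by positivity
    have p3 : 0 ≤ ‖γ - x‖ ^ (1 / 2 : ℝ) := by positivity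
    have p4 : 0 ≤ |x| ^ (-(1 / 2) : ℝ) := by positivity
    have := mul_nonneg (mul_nonneg p1 p3) p4
    have := mul_nonneg p2 p3
    linarith
  have hconv : ∀ x : ℝ, x ≠ 0 → Tendsto (fun n => F n x) atTop (𝓝 (f x)) := by
    intro x hx
    refine (hlim x hx).comp (tendsto_nhdsWithin_iff.2 ⟨?_, Eventually.of_forall fun n =>
      discToHalfPlane_im_pos him (norm_mul_lineToCircle_lt him (hr0 n) (hr1 n) x)⟩)
    have hcont : ContinuousAt (discToHalfPlane γ) (lineToCircle γ x) := by
      unfold discToHalfPlane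
      exact ContinuousAt.div (by fun_prop) (by fun_prop) (one_add_lineToCircle_ne_zero him x)
    have h1 : Tendsto (fun n => (r n : ℂ) * lineToCircle γ x) atTop (𝓝 (lineToCircle γ x)) := by
      simpa using ((Complex.continuous_ofReal.tendsto 1).comp hrlim).mul_const (lineToCircle γ x)
    have h2 := hcont.tendsto.comp h1
    rwa [discToHalfPlane_lineToCircle him] at h2
  have hint := tendsto_integral_of_dominated_convergence G hFm hGint
    (fun n => hx0.mono fun x hx => hbound n x hx) (hx0.mono fun x hx => hconv x hx)
  refine ⟨hGint.mono' (hm.comp (by fun_prop)).aestronglyMeasurable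
    (hx0.mono fun x hx => le_of_tendsto' (hconv x hx).norm fun n => hbound n x hx), ?_⟩
  refine tendsto_nhds_unique hint ?_
  simp only [hF, hγ, integral_discToHalfPlane_lineToCircle hf hm μ hσ (hr0 _) (hr1 _)]
  exact tendsto_const_nhds

/-! ### Growth and boundary values of the logarithm. -/

/-- Apply `log u ≤ u - 1` to `s = ‖z‖^(1/4)` and to `s⁻¹`. The quarter power is chosen so that the
square of the logarithm grows with exponent `1/2`. -/
theorem norm_log_add_le {z : ℂ} (hz : z ≠ 0) (c : ℂ) :
    ‖Complex.log z + c‖ ≤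
      (4 + Real.pi + ‖c‖) * (‖z‖ ^ (1 / 4 : ℝ) + (‖z‖ ^ (1 / 4 : ℝ))⁻¹) := by
  have hz' : 0 < ‖z‖ := norm_pos_iff.2 hz
  set s : ℝ := ‖z‖ ^ (1 / 4 : ℝ) with hs
  have hs0 : 0 < s := by positivity
  have hlog : Real.log s = 1 / 4 * Real.log ‖z‖ := Real.log_rpow hz' _
  have h1 := Real.log_le_sub_one_of_pos hs0
  have h2 := Real.log_le_sub_one_of_pos (inv_pos.2 hs0)
  rw [Real.log_inv] at h2
  have hs1 : 0 < s⁻¹ := inv_pos.2 hs0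
  have h3 : |Real.log ‖z‖| ≤ 4 * (s + s⁻¹) := abs_le.2 ⟨by linarith, by linarith⟩
  have h4 : 1 ≤ s + s⁻¹ := by
    by_cases h : 1 ≤ s
    · linarith
    · have := (one_le_inv₀ hs0).2 (not_le.1 h).le
      linarith
  have h5 : ‖Complex.log z‖ ≤ |Real.log ‖z‖| + Real.pi := by
    refine (Complex.norm_le_abs_re_add_abs_im _).trans ?_
    rw [Complex.log_re, Complex.log_im]
    linarith [Complex.abs_arg_le_pi z]
  refine (norm_add_le _ _).trans ?_
  nlinarith [norm_nonneg c, Real.pi_pos]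

theorem norm_log_add_sq_le {z : ℂ} (hz : z ≠ 0) (c : ℂ) :
    ‖Complex.log z + c‖ ^ 2 ≤
      2 * (4 + Real.pi + ‖c‖) ^ 2 * (‖z‖ ^ (1 / 2 : ℝ) + ‖z‖ ^ (-(1 / 2) : ℝ)) := by
  have hz' : 0 < ‖z‖ := norm_pos_iff.2 hz
  have h := norm_log_add_le hz c
  have h2 : ‖z‖ ^ (1 / 2 : ℝ) = (‖z‖ ^ (1 / 4 : ℝ)) ^ 2 := by
    rw [← Real.rpow_natCast, ← Real.rpow_mul hz'.le]; norm_num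
  rw [Real.rpow_neg hz'.le, h2]
  set s : ℝ := ‖z‖ ^ (1 / 4 : ℝ)
  calc ‖Complex.log z + c‖ ^ 2 ≤ ((4 + Real.pi + ‖c‖) * (s + s⁻¹)) ^ 2 :=
        pow_le_pow_left₀ (norm_nonneg _) h 2
    _ = (4 + Real.pi + ‖c‖) ^ 2 * (s + s⁻¹) ^ 2 := by ring
    _ ≤ (4 + Real.pi + ‖c‖) ^ 2 * (2 * (s ^ 2 + (s ^ 2)⁻¹)) := by
        refine mul_le_mul_of_nonneg_left ?_ (sq_nonneg _)
        rw [← inv_pow]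
        nlinarith [sq_nonneg (s - s⁻¹)]
    _ = _ := by ring

theorem one_le_rpow_half_add {u : ℝ} (hu : 0 < u) :
    1 ≤ u ^ (1 / 2 : ℝ) + u ^ (-(1 / 2) : ℝ) := by
  have h1 : 0 < u ^ (1 / 2 : ℝ) := by positivity
  have h2 : 0 < u ^ (-(1 / 2) : ℝ) := by positivity
  by_cases h : 1 ≤ u
  · linarith [Real.one_le_rpow h (show (0 : ℝ) ≤ 1 / 2 by norm_num)]
  · linarith [Real.one_le_rpow_of_pos_of_le_one_of_nonpos hu (not_le.1 h).le
      (show (-(1 / 2) : ℝ) ≤ 0 by norm_num)]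

theorem differentiableOn_log_add (c : ℂ) :
    DifferentiableOn ℂ (fun z => Complex.log z + c) {z | 0 < z.im} := fun _ hz =>
  ((Complex.differentiableAt_log (Or.inr (ne_of_gt hz))).add_const c).differentiableWithinAt

/-- On the negative axis the principal logarithm is continuous from above, where `arg = π`; the
approach through the upper half plane is what makes this enough. -/
theorem tendsto_log_add {x : ℝ} (hx : x ≠ 0) (c : ℂ) :
    Tendsto (fun z => Complex.log z + c) (𝓝[{z | 0 < z.im}] (x : ℂ))
      (𝓝 (Complex.log x + c)) := by
  refine Tendsto.add_const c ?_
  rcases hx.lt_or_gt with h | h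
  · have := Complex.continuousWithinAt_log_of_re_neg_of_im_zero (z := (x : ℂ)) (by simpa using h)
      (by simp)
    exact this.tendsto.mono_left (nhdsWithin_mono _ fun z (hz : 0 < z.im) => hz.le)
  · exact (continuousAt_clog (Or.inl (by simpa using h))).tendsto.mono_left nhdsWithin_le_nhds

theorem integrable_and_integral_log_add (c : ℂ) (μ : ℝ) {σ : NNReal} (hσ : 0 < σ) :
    Integrable (fun x : ℝ => Complex.log x + c) (cauchyMeasure μ σ) ∧
      ∫ x : ℝ, (Complex.log x + c) ∂(cauchyMeasure μ σ) =
        Complex.log (μ + σ * Complex.I) + c := by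
  refine integrable_and_integral_cauchyMeasure (f := fun z => Complex.log z + c)
    (differentiableOn_log_add c) (by fun_prop) (fun x hx => tendsto_log_add hx c)
    (C := 1 + 2 * (4 + Real.pi + ‖c‖) ^ 2) (fun z hz => ?_) μ hσ
  have h1 := norm_log_add_sq_le hz c
  have h2 := one_le_rpow_half_add (norm_pos_iff.2 hz)
  -- Uses `‖w‖ ≤ 1 + ‖w‖²`; the constant `1` is absorbed by `one_le_rpow_half_add`.
  nlinarith [sq_nonneg (‖Complex.log z + c‖ - 1)]

theorem integrable_and_integral_log_add_sq (c : ℂ) (μ : ℝ) {σ : NNReal} (hσ : 0 < σ) :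
    Integrable (fun x : ℝ => (Complex.log x + c) ^ 2) (cauchyMeasure μ σ) ∧
      ∫ x : ℝ, (Complex.log x + c) ^ 2 ∂(cauchyMeasure μ σ) =
        (Complex.log (μ + σ * Complex.I) + c) ^ 2 := by
  refine integrable_and_integral_cauchyMeasure (f := fun z => (Complex.log z + c) ^ 2)
    ((differentiableOn_log_add c).pow 2) (by fun_prop) (fun x hx => (tendsto_log_add hx c).pow 2)
    (C := 2 * (4 + Real.pi + ‖c‖) ^ 2) (fun z hz => ?_) μ hσ
  rw [norm_pow]
  exact norm_log_add_sq_le hz c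

/-! ### Gaussian quantiles. -/

theorem gaussianReal_real_Iic_normalUpperQuantile {a : ℝ} (h0 : 0 < a) (h1 : a < 1) :
    (gaussianReal 0 1).real (Set.Iic (normalUpperQuantile a)) = 1 - a := by
  rw [measureReal_def, gaussianReal_apply_eq_integral _ one_ne_zero,
    ENNReal.toReal_ofReal (integral_nonneg fun x => gaussianPDFReal_nonneg _ _ _),
    ← integral_Iic_normalUpperQuantile h0 h1]
  simp [gaussianPDFReal]

theorem gaussianReal_real_Iio_neg (r : ℝ) :
    (gaussianReal 0 1).real (Set.Iio (-r)) = (gaussianReal 0 1).real (Set.Ioi r) := by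
  have h := gaussianReal_map_neg (μ := 0) (v := 1)
  rw [neg_zero] at h
  conv_lhs => rw [← h]
  rw [map_measureReal_apply measurable_neg measurableSet_Iio]
  congr 1
  ext x
  simp

theorem normalUpperQuantile_nonneg {a : ℝ} (h0 : 0 < a) (h1 : a ≤ 1 / 2) :
    0 ≤ normalUpperQuantile a := by
  by_contra! hneg
  set r := normalUpperQuantile a
  have hr : (gaussianReal 0 1).real (Set.Iic r) = 1 - a :=
    gaussianReal_real_Iic_normalUpperQuantile h0 (by linarith)
  have hc : (gaussianReal 0 1).real (Set.Ioi r) = a := by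
    rw [← Set.compl_Iic, probReal_compl_eq_one_sub measurableSet_Iic, hr]
    ring
  -- Strict positivity is what settles the boundary case `a = 1 / 2`, that is `α = 1`.
  have hpos : 0 < (gaussianReal 0 1).real (Set.Ioo r (-r)) := by
    rw [measureReal_def, ENNReal.toReal_pos_iff]
    refine ⟨pos_iff_ne_zero.2 fun h => ?_, measure_lt_top _ _⟩
    have := gaussianReal_absolutelyContinuous' 0 (one_ne_zero (α := NNReal)) h
    rw [Real.volume_Ioo, ENNReal.ofReal_eq_zero] at this
    linarith
  have hsub : (gaussianReal 0 1).real (Set.Iic r) + (gaussianReal 0 1).real (Set.Ioo r (-r)) ≤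
      (gaussianReal 0 1).real (Set.Iio (-r)) := by
    rw [← measureReal_union _ measurableSet_Ioo]
    · refine measureReal_mono ?_
      rintro x (hx | hx)
      · exact lt_of_le_of_lt (Set.mem_Iic.1 hx) (by linarith)
      · exact hx.2
    · exact Set.disjoint_left.2 fun x hx hx' => not_lt.2 hx hx'.1
  rw [gaussianReal_real_Iio_neg] at hsub
  linarith

theorem gaussianReal_real_abs_le {α : ℝ} (hα₀ : 0 < α) (hα₁ : α ≤ 1) :
    (gaussianReal 0 1).real {z | |z| ≤ normalUpperQuantile (α / 2)} = 1 - α := by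
  set r := normalUpperQuantile (α / 2)
  have hr0 : 0 ≤ r := normalUpperQuantile_nonneg (by linarith) (by linarith)
  have hr : (gaussianReal 0 1).real (Set.Iic r) = 1 - α / 2 :=
    gaussianReal_real_Iic_normalUpperQuantile (by linarith) (by linarith)
  have hc : (gaussianReal 0 1).real (Set.Ioi r) = α / 2 := by
    rw [← Set.compl_Iic, probReal_compl_eq_one_sub measurableSet_Iic, hr]
    ring
  have hset : {z : ℝ | |z| ≤ r} = Set.Iic r \ Set.Iio (-r) := by
    ext z
    simp [abs_le, and_comm]
  rw [hset, measureReal_sdiff _ measurableSet_Iio, hr, gaussianReal_real_Iio_neg, hc]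
  · ring
  · exact fun x hx => (Set.mem_Iio.1 hx).le.trans (by linarith)

/-! ### Convergence in distribution and the isotropic central limit theorem. -/

section

variable {Ω Ω' : Type*} [MeasurableSpace Ω] [MeasurableSpace Ω'] {P : Measure Ω}
  [IsProbabilityMeasure P] {P' : Measure Ω'} [IsProbabilityMeasure P']

/-- The portmanteau theorem for a random variable whose limit has no atom at the endpoint. -/
theorem MeasureTheory.TendstoInDistribution.tendsto_real_le {X : ℕ → Ω → ℝ} {Z : Ω' → ℝ}
    (h : TendstoInDistribution X atTop Z (fun _ => P) P') {a : ℝ} (ha : P' {ω | Z ω = a} = 0) :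
    Tendsto (fun n => P.real {ω | X n ω ≤ a}) atTop (𝓝 (P'.real {ω | Z ω ≤ a})) := by
  have hfr : (P'.map Z) (frontier (Set.Iic a)) = 0 := by
    rw [frontier_Iic, Measure.map_apply_of_aemeasurable h.aemeasurable_limit
      (measurableSet_singleton a)]
    exact ha
  have := ProbabilityMeasure.tendsto_measure_of_null_frontier_of_tendsto' h.tendsto
    (E := Set.Iic a) hfr
  simp only [ProbabilityMeasure.coe_mk] at this
  rw [Measure.map_apply_of_aemeasurable h.aemeasurable_limit measurableSet_Iic] at this
  simp only [fun n => Measure.map_apply_of_aemeasurable (h.forall_aemeasurable n)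
    (measurableSet_Iic (a := a))] at this
  exact (ENNReal.tendsto_toReal (measure_ne_top _ _)).comp this

/-- A sequence which converges in distribution times one which converges to `0` in probability
converges to `0` in probability. -/
theorem MeasureTheory.TendstoInDistribution.tendstoInMeasure_mul_zero {X Y : ℕ → Ω → ℝ}
    {Z : Ω' → ℝ} (h : TendstoInDistribution X atTop Z (fun _ => P) P')
    (hY : TendstoInMeasure P Y atTop (fun _ => (0 : ℝ))) (hYm : ∀ n, AEMeasurable (Y n) P) :
    TendstoInMeasure P (fun n ω => X n ω * Y n ω) atTop (fun _ => (0 : ℝ)) := by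
  -- The sign turns `{ε ≤ |X Y|}` into an event of the form `{· ≤ -ε}`; the limit is the constant
  -- `0`, for which this event is empty.
  have h1 := h.continuous_comp_prodMk_of_tendstoInMeasure_const
    (g := fun p : ℝ × ℝ => -|p.1 * p.2|) (by fun_prop) hY hYm
  rw [tendstoInMeasure_iff_measureReal_norm]
  intro ε hε
  have h2 := h1.tendsto_real_le (a := -ε) (by simp [hε.ne'])
  simpa [hε.not_ge] using h2

theorem re_sq_eq (w : ℂ) : w.re ^ 2 = (‖w‖ ^ 2 + (w ^ 2).re) / 2 := by
  rw [← Complex.normSq_eq_norm_sq, Complex.normSq_apply, sq, sq, Complex.mul_re]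
  ring

/-- The central limit theorem for a linear functional of a complex random variable `U` with
`E U = 0` and `E U² = 0`: the limit is isotropic. -/
theorem tendstoInDistribution_re_mul_sum {U : ℕ → Ω → ℂ} (hindep : iIndepFun U P)
    (hident : ∀ i, IdentDistrib (U i) (U 0) P P) (hU : MemLp (U 0) 2 P)
    (h1 : ∫ ω, U 0 ω ∂P = 0) (h2 : ∫ ω, U 0 ω ^ 2 ∂P = 0) (d : ℂ) :
    TendstoInDistribution
      (fun (n : ℕ) ω => (Real.sqrt n)⁻¹ * ∑ j ∈ Finset.range n, (d * U j ω).re) atTop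
      (fun z => ‖d‖ * Real.sqrt ((∫ ω, ‖U 0 ω‖ ^ 2 ∂P) / 2) * z) (fun _ => P)
      (gaussianReal 0 1) := by
  have hmeas : Measurable fun z : ℂ => (d * z).re := by fun_prop
  have hYL : MemLp (fun ω => (d * U 0 ω).re) 2 P := (hU.const_mul d).re
  have hmean : ∫ ω, (d * U 0 ω).re ∂P = 0 := by
    have := integral_re ((hU.const_mul d).integrable one_le_two)
    simp only [RCLike.re_to_complex] at this
    rw [this, integral_const_mul, h1]
    simp
  have hsqi : Integrable (fun ω => U 0 ω ^ 2) P := by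
    refine (hU.integrable_norm_pow (p := 2) two_ne_zero).mono' (hU.1.pow 2)
      (ae_of_all _ fun ω => ?_)
    simp
  -- By `re_sq_eq` only `E |d U|² / 2` remains, since the other term is the real part of `d² E U² =
  -- 0`.
  have hvar : Var[fun ω => (d * U 0 ω).re; P] = ‖d‖ ^ 2 * ((∫ ω, ‖U 0 ω‖ ^ 2 ∂P) / 2) := by
    rw [variance_of_integral_eq_zero hYL.1.aemeasurable hmean]
    simp_rw [re_sq_eq, mul_pow, norm_mul, mul_pow]
    have hre := integral_re (hsqi.const_mul (d ^ 2))
    simp only [RCLike.re_to_complex] at hre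
    rw [integral_div, integral_add, hre, integral_const_mul, integral_const_mul, h2]
    · simp
      ring
    · exact (hU.integrable_norm_pow (p := 2) two_ne_zero).const_mul _
    · exact (hsqi.const_mul (d ^ 2)).re
  have hv0 : 0 ≤ ∫ ω, ‖U 0 ω‖ ^ 2 ∂P := integral_nonneg fun ω => by positivity
  have hlaw : HasLaw (fun z : ℝ => ‖d‖ * Real.sqrt ((∫ ω, ‖U 0 ω‖ ^ 2 ∂P) / 2) * z)
      (gaussianReal 0 (Var[fun ω => (d * U 0 ω).re; P]).toNNReal) (gaussianReal 0 1) := by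
    have h := gaussianReal_const_mul (μ := 0) (v := 1) (P := gaussianReal 0 1) (X := id)
      ⟨aemeasurable_id, Measure.map_id⟩ (‖d‖ * Real.sqrt ((∫ ω, ‖U 0 ω‖ ^ 2 ∂P) / 2))
    convert! h using 2
    · simp
    · rw [mul_one]
      apply NNReal.eq
      rw [hvar, Real.coe_toNNReal _ (by positivity)]
      rw [NNReal.coe_mk, mul_pow, Real.sq_sqrt (div_nonneg hv0 zero_le_two)]
  have := tendstoInDistribution_inv_sqrt_mul_sum_sub (X := fun j ω => (d * U j ω).re) hlaw hYL
    (hindep.comp (fun _ z => (d * z).re) fun _ => hmeas) (fun i => (hident i).comp hmeas)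
  simpa only [hmean, mul_zero, sub_zero] using this

end

/-! ### The delta method and studentization. -/

/-- Writing `exp z - 1 = z g(z)` with `g` continuous and `g(0) = 1` replaces a Taylor remainder
estimate. -/
theorem continuous_dslope_exp : Continuous (dslope Complex.exp 0) := by
  rw [← continuousOn_univ, continuousOn_dslope univ_mem]
  exact ⟨Complex.continuous_exp.continuousOn, Complex.differentiable_exp 0⟩

theorem exp_sub_one_eq_mul_dslope (z : ℂ) : Complex.exp z - 1 = z * dslope Complex.exp 0 z := by
  have := sub_smul_dslope Complex.exp 0 z
  simpa using this.symm

section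

variable {Ω : Type*} [MeasurableSpace Ω] {P : Measure Ω} [IsProbabilityMeasure P]

/-- The delta method for `exp` of the empirical mean of a complex random variable with vanishing
pseudo-variance. -/
theorem tendstoInDistribution_re_exp_mean {U : ℕ → Ω → ℂ} (hindep : iIndepFun U P)
    (hident : ∀ i, IdentDistrib (U i) (U 0) P P) (hU : MemLp (U 0) 2 P)
    (h1 : ∫ ω, U 0 ω ∂P = 0) (h2 : ∫ ω, U 0 ω ^ 2 ∂P = 0) (d : ℂ) :
    TendstoInDistribution
      (fun (n : ℕ) ω => Real.sqrt n *
        (d * (Complex.exp ((n : ℝ)⁻¹ • ∑ j ∈ Finset.range n, U j ω) - 1)).re) atTop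
      (fun z => ‖d‖ * Real.sqrt ((∫ ω, ‖U 0 ω‖ ^ 2 ∂P) / 2) * z) (fun _ => P)
      (gaussianReal 0 1) := by
  have hUm : ∀ j, AEMeasurable (U j) P := fun j => (hident j).aemeasurable_fst
  set A : ℕ → Ω → ℂ := fun n ω => (n : ℝ)⁻¹ • ∑ j ∈ Finset.range n, U j ω with hA
  have hAm : ∀ n, AEMeasurable (A n) P := fun n => by
    simp only [hA]
    exact AEMeasurable.fun_const_smul (Finset.aemeasurable_fun_sum _ fun j _ => hUm j) ((n : ℝ)⁻¹)
  have hA0 : ∀ᵐ ω ∂P, Tendsto (fun n => A n ω) atTop (𝓝 0) := by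
    have := strong_law_ae U (hU.integrable one_le_two)
      (fun i j hij => hindep.indepFun hij) hident
    rwa [h1] at this
  have hp : ∀ᵐ ω ∂P, Tendsto (fun n => dslope Complex.exp 0 (A n ω)) atTop (𝓝 1) := by
    filter_upwards [hA0] with ω hω
    have := (continuous_dslope_exp.tendsto 0).comp hω
    simpa [Function.comp_def] using this
  have hpm : ∀ n, AEMeasurable (fun ω => dslope Complex.exp 0 (A n ω)) P :=
    fun n => continuous_dslope_exp.measurable.comp_aemeasurable (hAm n)
  have hre : TendstoInMeasure P (fun n ω => (dslope Complex.exp 0 (A n ω)).re) atTop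
      (fun _ => (1 : ℝ)) := by
    refine tendstoInMeasure_of_tendsto_ae
      (fun n => (Complex.measurable_re.comp_aemeasurable (hpm n)).aestronglyMeasurable) ?_
    filter_upwards [hp] with ω hω
    simpa [Function.comp_def] using (Complex.continuous_re.tendsto _).comp hω
  have him : TendstoInMeasure P (fun n ω => (dslope Complex.exp 0 (A n ω)).im) atTop
      (fun _ => (0 : ℝ)) := by
    refine tendstoInMeasure_of_tendsto_ae
      (fun n => (Complex.measurable_im.comp_aemeasurable (hpm n)).aestronglyMeasurable) ?_
    filter_upwards [hp] with ω hω
    simpa [Function.comp_def] using (Complex.continuous_im.tendsto _).comp hω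
  -- With `A` the mean and `g = dslope exp 0 A`, `Re (d A g) = Re (d A) Re g + Re (i d A) Im g`.
  -- After scaling, the first term keeps the Gaussian limit as `Re g → 1`, and the second vanishes
  -- as `Im g → 0`.
  have hT := tendstoInDistribution_re_mul_sum hindep hident hU h1 h2 d
  have hT' := tendstoInDistribution_re_mul_sum hindep hident hU h1 h2 (Complex.I * d)
  have hM := hT'.tendstoInMeasure_mul_zero him
    fun n => Complex.measurable_im.comp_aemeasurable (hpm n)
  have hS := hT.continuous_comp_prodMk_of_tendstoInMeasure_const
    (g := fun p : ℝ × ℝ => p.1 * p.2) (by fun_prop) hre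
    fun n => Complex.measurable_re.comp_aemeasurable (hpm n)
  have hfin := hS.add_of_tendstoInMeasure_const hM fun n =>
    (hT'.forall_aemeasurable n).mul (Complex.measurable_im.comp_aemeasurable (hpm n))
  refine TendstoInDistribution.congr (fun n => ae_of_all _ fun ω => ?_)
    (ae_of_all _ fun z => ?_) hfin
  · simp only [Pi.add_apply]
    rcases Nat.eq_zero_or_pos n with rfl | hn
    · simp
    have hn' : (0 : ℝ) < n := by exact_mod_cast hn
    have hsum : ∀ e : ℂ, (Real.sqrt n)⁻¹ * ∑ j ∈ Finset.range n, (e * U j ω).re =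
        Real.sqrt n * (e * A n ω).re := by
      intro e
      rw [← Complex.re_sum, ← Finset.mul_sum]
      have : ∑ j ∈ Finset.range n, U j ω = (n : ℝ) • A n ω := by
        simp only [hA]
        rw [smul_inv_smul₀ hn'.ne']
      rw [this, mul_smul_comm, Complex.smul_re, smul_eq_mul, ← mul_assoc]
      congr 1
      rw [inv_mul_eq_div, Real.div_sqrt]
    change _ = Real.sqrt n * (d * (Complex.exp (A n ω) - 1)).re
    rw [hsum, hsum, exp_sub_one_eq_mul_dslope]
    simp only [Complex.mul_re, Complex.mul_im, Complex.I_re, Complex.I_im]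
    ring
  · simp

/-- Coverage probability of the confidence interval for a coordinate of `exp (E L)` which is
built from the empirical mean of `L` and an estimator `V` of its variance. -/
theorem tendsto_measureReal_abs_re_exp_mean_le {L : ℕ → Ω → ℂ} (hindep : iIndepFun L P)
    (hident : ∀ i, IdentDistrib (L i) (L 0) P P) (hL : MemLp (L 0) 2 P) {m : ℂ}
    (h1 : ∫ ω, L 0 ω ∂P = m) (h2 : ∫ ω, (L 0 ω - m) ^ 2 ∂P = 0)
    {v : ℝ} (hv : ∫ ω, ‖L 0 ω - m‖ ^ 2 ∂P = v) (hv0 : 0 < v) {V : ℕ → Ω → ℝ}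
    (hVm : ∀ n, AEMeasurable (V n) P)
    (hV : ∀ᵐ ω ∂P, Tendsto (fun n => V n ω) atTop (𝓝 v)) {c : ℂ} (hc : ‖c‖ = 1) (ρ : ℝ) :
    Tendsto (fun n : ℕ => P.real {ω |
        |(c * (Complex.exp ((n : ℝ)⁻¹ • ∑ j ∈ Finset.range n, L j ω) - Complex.exp m)).re| ≤
          Real.sqrt (V n ω) * ‖Complex.exp ((n : ℝ)⁻¹ • ∑ j ∈ Finset.range n, L j ω)‖ /
            Real.sqrt (2 * n) * ρ})
      atTop (𝓝 ((gaussianReal 0 1).real {z | |z| ≤ ρ})) := by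
  have hLm : ∀ j, AEMeasurable (L j) P := fun j => (hident j).aemeasurable_fst
  have hmeas : Measurable fun z : ℂ => z - m := by fun_prop
  have hT := tendstoInDistribution_re_exp_mean (U := fun j ω => L j ω - m)
    (hindep.comp (fun _ z => z - m) fun _ => hmeas) (fun i => (hident i).comp hmeas)
    (hL.sub (memLp_const m))
    (by rw [integral_sub (hL.integrable one_le_two) (integrable_const m), h1]; simp) h2
    (c * Complex.exp m)
  rw [hv, norm_mul, hc, one_mul] at hT
  set G : ℕ → Ω → ℂ := fun n ω =>
    Complex.exp ((n : ℝ)⁻¹ • ∑ j ∈ Finset.range n, L j ω) with hG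
  have hGm : ∀ n, AEMeasurable (G n) P := fun n => Complex.measurable_exp.comp_aemeasurable
    (AEMeasurable.fun_const_smul (Finset.aemeasurable_fun_sum _ fun j _ => hLm j) ((n : ℝ)⁻¹))
  have hG0 : ∀ᵐ ω ∂P, Tendsto (fun n => G n ω) atTop (𝓝 (Complex.exp m)) := by
    have := strong_law_ae L (hL.integrable one_le_two)
      (fun i j hij => hindep.indepFun hij) hident
    rw [h1] at this
    filter_upwards [this] with ω hω
    exact (Complex.continuous_exp.tendsto m).comp hω
  set W : ℕ → Ω → ℝ := fun n ω => Real.sqrt (V n ω / 2) * ‖G n ω‖ with hW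
  have hWm : ∀ n, AEMeasurable (W n) P := fun n =>
    ((hVm n).div_const 2).sqrt.mul (hGm n).norm
  have hWlim : TendstoInMeasure P W atTop fun _ => ‖Complex.exp m‖ * Real.sqrt (v / 2) := by
    refine tendstoInMeasure_of_tendsto_ae (fun n => (hWm n).aestronglyMeasurable) ?_
    filter_upwards [hV, hG0] with ω h h'
    rw [mul_comm]
    exact ((h.div_const 2).sqrt).mul h'.norm
  set s : ℝ := ‖Complex.exp m‖ * Real.sqrt (v / 2) with hs
  have hs0 : 0 < s := by
    have : 0 < ‖Complex.exp m‖ := norm_pos_iff.2 (Complex.exp_ne_zero m)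
    positivity
  -- For `n > 0` coverage is the event that this quantity is at most `0`; its limit `s (|z| - ρ)`
  -- has no atom at `0`.
  have hD := hT.continuous_comp_prodMk_of_tendstoInMeasure_const
    (g := fun p : ℝ × ℝ => |p.1| - p.2 * ρ) (by fun_prop) hWlim hWm
  have hz : ∀ z : ℝ, |s * z| - s * ρ = s * (|z| - ρ) := fun z => by
    rw [abs_mul, abs_of_pos hs0]; ring
  have hfin := hD.tendsto_real_le (a := 0) (by
    have hsub : {z : ℝ | |s * z| - s * ρ = 0} ⊆ {ρ, -ρ} := by
      intro z h
      rw [Set.mem_ofPred_eq, hz, mul_eq_zero, or_iff_right hs0.ne', sub_eq_zero] at h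
      have := eq_or_eq_neg_of_abs_eq h
      simpa using this
    have : NullSingletonClass (gaussianReal 0 1) := nullSingletonClass_gaussianReal one_ne_zero
    exact measure_mono_null hsub ((Set.toFinite _).measure_zero _))
  have hlim : {z : ℝ | |s * z| - s * ρ ≤ 0} = {z | |z| ≤ ρ} := by
    ext z
    rw [Set.mem_ofPred_eq, hz, Set.mem_ofPred_eq, mul_nonpos_iff_pos_imp_nonpos]
    constructor
    · intro h; linarith [h.1 hs0]
    · intro h; exact ⟨fun _ => by linarith, fun _ => hs0.le⟩
  simp only [hlim] at hfin
  refine hfin.congr' ?_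
  filter_upwards [eventually_gt_atTop 0] with n hn
  have hn' : (0 : ℝ) < n := by exact_mod_cast hn
  congr 1
  ext ω
  have hmean : Complex.exp m * Complex.exp ((n : ℝ)⁻¹ • ∑ j ∈ Finset.range n, (L j ω - m)) =
      G n ω := by
    rw [← Complex.exp_add, Finset.sum_sub_distrib, smul_sub]
    congr 1
    simp only [Finset.sum_const, Finset.card_range, nsmul_eq_mul, Complex.real_smul]
    push_cast
    have : (n : ℂ) ≠ 0 := by exact_mod_cast hn.ne'
    field_simp
    ring
  have hre : Real.sqrt n * (c * Complex.exp m *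
      (Complex.exp ((n : ℝ)⁻¹ • ∑ j ∈ Finset.range n, (L j ω - m)) - 1)).re =
      Real.sqrt n * (c * (G n ω - Complex.exp m)).re := by
    rw [← hmean]
    congr 2
    ring
  have hn2 : 0 < Real.sqrt n := Real.sqrt_pos.2 hn'
  have hhalf : Real.sqrt (V n ω) * ‖G n ω‖ / Real.sqrt (2 * n) * ρ =
      W n ω * ρ / Real.sqrt n := by
    simp only [hW]
    rw [Real.sqrt_div' _ zero_le_two, Real.sqrt_mul zero_le_two]
    field_simp
  rw [Set.mem_ofPred_eq, Set.mem_ofPred_eq, hre, abs_mul, abs_of_pos hn2, hhalf, le_div_iff₀ hn2,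
    sub_nonpos, mul_comm]

end

/-! ### The statistics in terms of the logarithms. -/

theorem measurable_branchLog (k : ℤ) : Measurable (branchLog k) := by
  unfold branchLog
  fun_prop

theorem geomMean_eq_exp (k : ℤ) (x : ℕ → ℝ) (N : ℕ) :
    geomMean k x N = Complex.exp ((N : ℝ)⁻¹ • ∑ j ∈ Finset.range N, branchLog k (x j)) := by
  simp only [geomMean, branchPow]
  rw [← Complex.exp_sum, ← Finset.mul_sum, Complex.real_smul]
  push_cast
  rw [one_div]

/-- In this form the strong law applies to each empirical mean, and the factor `N / (N - 1)` tends
to `1`. -/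
theorem logVariance_eq (k : ℤ) (x : ℕ → ℝ) (N : ℕ) :
    logVariance k x N =
      (N : ℝ) / (N + -1) * ((N : ℝ)⁻¹ • ∑ j ∈ Finset.range N, ‖branchLog k (x j)‖ ^ 2) -
        ‖(N : ℝ)⁻¹ • ∑ j ∈ Finset.range N, branchLog k (x j)‖ ^ 2 := by
  have h1 : (N : ℝ) / (N + -1) * ((N : ℝ)⁻¹ • ∑ j ∈ Finset.range N, ‖branchLog k (x j)‖ ^ 2) =
      1 / ((N : ℝ) - 1) * ∑ j ∈ Finset.range N, ‖branchLog k (x j)‖ ^ 2 := by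
    rcases Nat.eq_zero_or_pos N with rfl | hN
    · simp
    · have : (N : ℝ) ≠ 0 := by exact_mod_cast hN.ne'
      rw [smul_eq_mul, ← mul_assoc, ← sub_eq_add_neg]
      congr 1
      field_simp
  have h2 : (N : ℝ)⁻¹ • ∑ j ∈ Finset.range N, branchLog k (x j) =
      1 / (N : ℂ) * ∑ j ∈ Finset.range N, branchLog k (x j) := by
    rw [Complex.real_smul]
    push_cast
    rw [one_div]
  rw [logVariance, h1, h2]

/-- No value of `branchLog k` on the real line is the logarithm of a point of the upper half
plane. -/
theorem branchLog_ne_log_add (k : ℤ) {γ : ℂ} (hγ : 0 < γ.im) (x : ℝ) :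
    branchLog k x ≠ Complex.log γ + (2 * (k : ℝ) * Real.pi : ℝ) * Complex.I := by
  intro h
  rw [branchLog, add_left_inj] at h
  have h1 := congrArg Complex.im h
  rw [Complex.log_im, Complex.log_im] at h1
  have h2 : Complex.arg γ ≠ 0 := fun h0 => hγ.ne' (Complex.arg_eq_zero_iff.1 h0).2
  have h3 : Complex.arg γ ≠ Real.pi := fun h0 => hγ.ne' (Complex.arg_eq_pi_iff.1 h0).2
  rcases le_or_gt 0 x with hx | hx
  · exact h2 (h1.symm.trans (Complex.arg_ofReal_of_nonneg hx))
  · exact h3 (h1.symm.trans (Complex.arg_ofReal_of_neg hx))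

section

variable {Ω : Type*} [MeasurableSpace Ω] {P : Measure Ω} [IsProbabilityMeasure P]

theorem integral_norm_sub_mean_sq {Y : Ω → ℂ} (hY : MemLp Y 2 P) {m : ℂ} (hm : ∫ ω, Y ω ∂P = m) :
    ∫ ω, ‖Y ω - m‖ ^ 2 ∂P = ∫ ω, ‖Y ω‖ ^ 2 ∂P - ‖m‖ ^ 2 := by
  have h : ∀ ω, ‖Y ω - m‖ ^ 2 =
      ‖Y ω‖ ^ 2 - 2 * RCLike.re ((starRingEnd ℂ) m * Y ω) + ‖m‖ ^ 2 := by
    intro ω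
    simp only [← Complex.normSq_eq_norm_sq, Complex.normSq_apply, Complex.sub_re, Complex.sub_im,
      RCLike.re_to_complex, Complex.mul_re, Complex.conj_re, Complex.conj_im]
    ring
  have hi := (hY.integrable one_le_two).const_mul ((starRingEnd ℂ) m)
  have hi2 := hY.integrable_norm_pow (p := 2) two_ne_zero
  simp_rw [h]
  rw [integral_add (f := fun ω => ‖Y ω‖ ^ 2 - 2 * RCLike.re ((starRingEnd ℂ) m * Y ω))
    (hi2.sub (hi.re.const_mul 2)) (integrable_const _),
    integral_sub hi2 (hi.re.const_mul 2), integral_const_mul, integral_re hi, integral_const_mul,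
    hm]
  have : RCLike.re ((starRingEnd ℂ) m * m) = ‖m‖ ^ 2 := by
    rw [← Complex.normSq_eq_norm_sq, Complex.normSq_apply]
    simp
  rw [this]
  simp
  ring

end

/-! ### Coverage of both intervals. -/

theorem mainTheorem5 {Ω : Type*} [MeasurableSpace Ω] (P : Measure Ω) [IsProbabilityMeasure P]
    (μ : ℝ) (σ : NNReal) (hσ : 0 < σ)
    (X : ℕ → Ω → ℝ) (hlaw : ∀ j, HasLaw (X j) (cauchyMeasure μ σ) P) (hindep : iIndepFun X P)
    (k : ℤ) (α : ℝ) (hα₀ : 0 < α) (hα₁ : α ≤ 1) :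
    Tendsto (fun N : ℕ => P.real {ω |
        (geomMean k (fun j => X j ω) N).re - ciHalfWidth k (fun j => X j ω) N α ≤ μ ∧
        μ ≤ (geomMean k (fun j => X j ω) N).re + ciHalfWidth k (fun j => X j ω) N α})
      atTop (𝓝 (1 - α)) ∧
    Tendsto (fun N : ℕ => P.real {ω |
        (geomMean k (fun j => X j ω) N).im - ciHalfWidth k (fun j => X j ω) N α ≤ (σ : ℝ) ∧
        (σ : ℝ) ≤ (geomMean k (fun j => X j ω) N).im + ciHalfWidth k (fun j => X j ω) N α})
      atTop (𝓝 (1 - α)) := by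
  have hσ' : (0 : ℝ) < σ := by exact_mod_cast hσ
  set γ : ℂ := μ + σ * Complex.I with hγ
  have him : 0 < γ.im := by simpa [hγ] using hσ'
  set c₀ : ℂ := (2 * (k : ℝ) * Real.pi : ℝ) * Complex.I with hc₀
  set m : ℂ := Complex.log γ + c₀ with hm
  -- The choice of branch disappears on exponentiating, since `exp (2kπi) = 1`.
  have hexp : Complex.exp m = γ := by
    have hper : Complex.exp c₀ = 1 := Complex.exp_eq_one_iff.2 ⟨k, by
      rw [hc₀]; push_cast; ring⟩
    rw [hm, Complex.exp_add, hper, mul_one, Complex.exp_log (fun h => by simp [h] at him)]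
  obtain ⟨hi1, he1⟩ := integrable_and_integral_log_add c₀ μ hσ
  obtain ⟨hi2, he2⟩ := integrable_and_integral_log_add_sq c₀ μ hσ
  have hbm := measurable_branchLog k
  set L : ℕ → Ω → ℂ := fun j ω => branchLog k (X j ω) with hLdef
  have hXm : ∀ j, AEMeasurable (X j) P := fun j => (hlaw j).aemeasurable
  have hident : ∀ i, IdentDistrib (L i) (L 0) P P := fun i =>
    IdentDistrib.comp ⟨hXm i, hXm 0, (hlaw i).map_eq.trans (hlaw 0).map_eq.symm⟩ hbm
  have hindepL : iIndepFun L P := hindep.comp (fun _ => branchLog k) fun _ => hbm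
  have hLm : ∀ j, AEMeasurable (L j) P := fun j => hbm.comp_aemeasurable (hXm j)
  have h1 : ∫ ω, L 0 ω ∂P = m := by
    refine Eq.trans ?_ he1
    rw [← (hlaw 0).map_eq]
    exact (integral_map (hXm 0) hbm.aestronglyMeasurable).symm
  have hL2i : Integrable (fun ω => L 0 ω ^ 2) P := by
    rw [← (hlaw 0).map_eq] at hi2
    exact hi2.comp_aemeasurable (hXm 0)
  have hL2 : ∫ ω, L 0 ω ^ 2 ∂P = m ^ 2 := by
    refine Eq.trans ?_ he2
    rw [← (hlaw 0).map_eq]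
    exact (integral_map (hXm 0) (hbm.pow_const 2).aestronglyMeasurable).symm
  have hL : MemLp (L 0) 2 P := by
    rw [memLp_two_iff_integrable_sq_norm (hLm 0).aestronglyMeasurable]
    simpa using hL2i.norm
  have h2 : ∫ ω, (L 0 ω - m) ^ 2 ∂P = 0 := by
    have h : ∀ ω, (L 0 ω - m) ^ 2 = L 0 ω ^ 2 - 2 * m * L 0 ω + m ^ 2 := fun ω => by ring
    have hi := (hL.integrable one_le_two).const_mul (2 * m)
    simp_rw [h]
    rw [integral_add (f := fun ω => L 0 ω ^ 2 - 2 * m * L 0 ω) (hL2i.sub hi) (integrable_const _),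
      integral_sub hL2i hi, integral_const_mul, h1, hL2]
    simp
    ring
  set v : ℝ := ∫ ω, ‖L 0 ω - m‖ ^ 2 ∂P with hv
  -- The integrand vanishes nowhere: up to the common shift `2kπ`, `L 0` has imaginary part `0` or
  -- `π`, while `arg γ` lies strictly between them.
  have hv0 : 0 < v := by
    rw [hv, integral_pos_iff_support_of_nonneg (f := fun ω => ‖L 0 ω - m‖ ^ 2)
      (fun ω => sq_nonneg _) ((hL.sub (memLp_const m)).integrable_norm_pow (p := 2) two_ne_zero)]
    have : Function.support (fun ω => ‖L 0 ω - m‖ ^ 2) = Set.univ := by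
      refine Set.eq_univ_of_forall fun ω => ?_
      exact pow_ne_zero 2 (norm_ne_zero_iff.2 (sub_ne_zero.2 (branchLog_ne_log_add k him _)))
    rw [this, measure_univ]
    exact one_pos
  set V : ℕ → Ω → ℝ := fun N ω => logVariance k (fun j => X j ω) N with hVdef
  have hVm : ∀ N, AEMeasurable (V N) P := fun N => by
    have := fun j => hbm.comp_aemeasurable (hXm j)
    simp only [hVdef, logVariance]
    fun_prop
  have hV : ∀ᵐ ω ∂P, Tendsto (fun N => V N ω) atTop (𝓝 v) := by
    have s1 := strong_law_ae L (hL.integrable one_le_two)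
      (fun i j hij => hindepL.indepFun hij) hident
    have hn : Measurable fun z : ℂ => ‖z‖ ^ 2 := by fun_prop
    have s2 := strong_law_ae (fun j ω => ‖L j ω‖ ^ 2)
      (hL.integrable_norm_pow (p := 2) two_ne_zero)
      (fun i j hij => (hindepL.indepFun hij).comp hn hn) (fun i => (hident i).comp hn)
    rw [h1] at s1
    filter_upwards [s1, s2] with ω t1 t2
    have t3 := ((tendsto_natCast_div_add_atTop (-1 : ℝ)).mul t2).sub (t1.norm.pow 2)
    rw [one_mul, ← integral_norm_sub_mean_sq hL h1] at t3
    simpa only [hVdef, logVariance_eq] using t3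
  have key : ∀ c : ℂ, ‖c‖ = 1 → Tendsto (fun N : ℕ => P.real {ω |
      |(c * (geomMean k (fun j => X j ω) N - γ)).re| ≤ ciHalfWidth k (fun j => X j ω) N α})
      atTop (𝓝 (1 - α)) := by
    intro c hc
    have := tendsto_measureReal_abs_re_exp_mean_le hindepL hident hL h1 h2 hv.symm hv0 hVm hV hc
      (normalUpperQuantile (α / 2))
    rw [gaussianReal_real_abs_le hα₀ hα₁, hexp] at this
    simpa only [ciHalfWidth, geomMean_eq_exp] using this
  constructor
  · refine (key 1 (by simp)).congr fun N => ?_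
    congr 1
    ext ω
    have : (1 * (geomMean k (fun j => X j ω) N - γ)).re =
        (geomMean k (fun j => X j ω) N).re - μ := by simp [hγ]
    rw [Set.mem_ofPred_eq, Set.mem_ofPred_eq, this, abs_le]
    constructor <;> rintro ⟨h, h'⟩ <;> constructor <;> linarith
  -- The direction `c = -i` selects the imaginary part, as `Re (-i w) = Im w`.
  · refine (key (-Complex.I) (by simp)).congr fun N => ?_
    congr 1
    ext ω
    have : (-Complex.I * (geomMean k (fun j => X j ω) N - γ)).re =
        (geomMean k (fun j => X j ω) N).im - σ := by simp [hγ]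
    rw [Set.mem_ofPred_eq, Set.mem_ofPred_eq, this, abs_le]
    constructor <;> rintro ⟨h, h'⟩ <;> constructor <;> linarith
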